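/- Let $P$ be a simplicial $d$-polytope, that is, a $d$-dimensional convex polytope all of whose proper faces are simplices. Its boundary complex $\Delta=\partial P$ is the simplicial complex whose faces are the vertex sets of the proper faces of $P$ (including the empty face). Suppose that $P$ is balanced: the graph ($1$-skeleton) of $\Delta$ is properly vertex $d$-colorable. For a simplicial complex $\Gamma$ of dimension $r-1$ let $f_{j-1}(\Gamma)$ be the number of faces of cardinality $j$, let $h_\Gamma(t)=\sum_{i=0}^{r}h_i(\Gamma)t^i=\sum_{j=0}^{r}f_{j-1}(\Gamma)\,t^j(1-t)^{r-j}$, and put $h_i(\Gamma)=0$ for $i<0$ and for $i>r$. For a vertex $v$ let $\mathrm{lk}_v(\Delta)=\{\tau\in\Delta:\ v\notin\tau,\ \tau\cup\{v\}\in\Delta\}$, and let $\Delta_0$ be the set of vertices of $\Delta$. Then: (1) coefficientwise, $$(1+t)\sum_{v\in\Delta_0}h_{\mathrm{lk}_v(\Delta)}(t)\ \le\ f_0(\Delta)\,h_\Delta(t);$$ (2) for all integers $i$ (in particular for all $0\le i\le d$), $$h_1(\Delta)\,h_i(\Delta)\ \ge\ (d-i+1)\,h_{i-1}(\Delta)+(i+1)\,h_{i+1}(\Delta).$$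 -/

import Mathlib

open Polynomial

noncomputable section

/-- A finite (abstract) simplicial complex: a finite collection of finite sets, its faces, closed
under taking subsets. The empty set is a face as soon as there is any face. -/
structure FinSimplicialComplex (α : Type*) where
  faces : Finset (Finset α)
  down_closed : ∀ σ ∈ faces, ∀ τ, τ ⊆ σ → τ ∈ faces

namespace FinSimplicialComplex

variable {α : Type*} (Δ : FinSimplicialComplex α)

open scoped Classical in
/-- The vertex set `Δ₀`. -/
def vertices : Finset α := Δ.faces.biUnion id

theorem mem_vertices (v : α) : v ∈ Δ.vertices ↔ {v} ∈ Δ.faces := by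
  classical
  simp only [vertices, Finset.mem_biUnion, id]
  constructor
  · rintro ⟨σ, hσ, hv⟩
    exact Δ.down_closed σ hσ _ (Finset.singleton_subset_iff.2 hv)
  · intro h
    exact ⟨{v}, h, Finset.mem_singleton_self v⟩

open scoped Classical in
/-- The graph (`1`-skeleton) of `Δ`, on the vertices of `Δ`. -/
def graph : SimpleGraph {v : α // v ∈ Δ.vertices} where
  Adj u v := u ≠ v ∧ ({u.1, v.1} : Finset α) ∈ Δ.faces
  symm := ⟨fun u v h => ⟨h.1.symm, by rw [Finset.pair_comm]; exact h.2⟩⟩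
  loopless := ⟨fun _ h => h.1 rfl⟩

open scoped Classical in
/-- The link of `σ` in `Δ`: all faces `τ` disjoint from `σ` with `σ ∪ τ` a face. -/
def link (σ : Finset α) : FinSimplicialComplex α where
  faces := Δ.faces.filter fun τ => σ ∪ τ ∈ Δ.faces ∧ Disjoint σ τ
  down_closed := by
    intro ρ hρ τ hτ
    rw [Finset.mem_filter] at hρ ⊢
    exact ⟨Δ.down_closed ρ hρ.1 τ hτ,
      Δ.down_closed _ hρ.2.1 _ (Finset.union_subset_union_right hτ),
      hρ.2.2.mono_right hτ⟩

/-- The size of the largest faces, that is, `dim Δ + 1`. -/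
def rank : ℕ := Δ.faces.sup Finset.card

/-- The number of faces of cardinality `j`, that is, `f_{j-1}(Δ)`. -/
def numFaces (j : ℕ) : ℕ := (Δ.faces.filter fun σ => σ.card = j).card

/-- The `h`-polynomial of `Δ`. With `r = dim Δ + 1` it is given by
`h(t) = ∑_{j=0}^{r} f_{j-1} t^j (1-t)^{r-j}`; for `t = 1/x` and multiplied by `x^r` this reads
`x^r h(1/x) = (x-1)^r ∑_{j=0}^{r} f_{j-1} (1/(x-1))^j`. -/
def hPoly : ℤ[X] :=
  ∑ j ∈ Finset.range (Δ.rank + 1), C (Δ.numFaces j : ℤ) * X ^ j * (1 - X) ^ (Δ.rank - j)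

/-- The entries `h_i(Δ)` of the `h`-vector, with `h_i = 0` for `i < 0` and for `i > dim Δ + 1`. -/
def hNum (i : ℤ) : ℤ := if 0 ≤ i then Δ.hPoly.coeff i.toNat else 0

end FinSimplicialComplex

/-- `F` is a proper face of the convex polytope `Q`: a face (the empty set, or the set of maximizers
over `Q` of a linear functional) other than `Q`. The empty set is a proper face. -/
def IsProperFace {E : Type*} [NormedAddCommGroup E] [NormedSpace ℝ E] (Q F : Set E) : Prop :=
  IsExposed ℝ Q F ∧ F ≠ Q

/-- A simplicial convex polytope in `E`, given by its vertices: a nonempty finite set of points in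
convex position, so that these points are exactly the vertices of their convex hull, such that the
vertices on each proper face of the convex hull are affinely independent. -/
structure SimplicialPolytope (E : Type*) [NormedAddCommGroup E] [NormedSpace ℝ E] where
  verts : Finset E
  nonempty : verts.Nonempty
  convexIndependent : ConvexIndependent ℝ ((↑) : verts → E)
  simplicial : ∀ F : Set E, IsProperFace (convexHull ℝ (verts : Set E)) F →
    AffineIndependent ℝ ((↑) : ((verts : Set E) ∩ F : Set E) → E)

namespace SimplicialPolytope

variable {E : Type*} [NormedAddCommGroup E] [NormedSpace ℝ E]

/-- The polytope as a set of points. -/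
def body (P : SimplicialPolytope E) : Set E := convexHull ℝ (P.verts : Set E)

/-- The dimension of the polytope, that is, of its affine hull. -/
def dim (P : SimplicialPolytope E) : ℕ := Module.finrank ℝ (vectorSpan ℝ P.body)

/-- Every set of vertices of a proper face of a simplicial polytope is the vertex set of a proper
face. -/
theorem exists_properFace_of_subset [FiniteDimensional ℝ E] (P : SimplicialPolytope E)
    {F : Set E} (hF : IsProperFace P.body F) {τ : Finset E}
    (hτ : (τ : Set E) ⊆ (P.verts : Set E) ∩ F) :
    ∃ G : Set E, IsProperFace P.body G ∧ (τ : Set E) = (P.verts : Set E) ∩ G := by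
  classical
  have hsub : (P.verts : Set E) ⊆ P.body := subset_convexHull ℝ _
  rcases τ.eq_empty_or_nonempty with rfl | ⟨t₀, ht₀⟩
  · refine ⟨∅, ⟨isExposed_empty, ?_⟩, by simp⟩
    intro h
    obtain ⟨v, hv⟩ := P.nonempty
    have := hsub hv
    rw [← h] at this
    exact this
  obtain ⟨l, hl⟩ := hF.1 ⟨t₀, (hτ ht₀).2⟩
  have hFmax : ∀ v ∈ (P.verts : Set E) ∩ F, ∀ y ∈ P.body, l y ≤ l v := by
    intro v hv
    have h2 := hv.2
    rw [hl] at h2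
    exact h2.2
  obtain ⟨s, hs, b, hbs⟩ : ∃ s : Set E, (P.verts : Set E) ∩ F ⊆ s ∧
      ∃ b : AffineBasis s ℝ E, ⇑b = ((↑) : s → E) := by
    obtain ⟨s, hs, hi, hsp⟩ := exists_subset_affineIndependent_affineSpan_eq_top (P.simplicial F hF)
    exact ⟨s, hs, ⟨(↑), hi, by rw [Subtype.range_coe]; exact hsp⟩, rfl⟩
  let T : Finset s := τ.attach.image fun t => ⟨t.1, hs (hτ t.2)⟩
  have hT : ∀ x : s, x ∈ T ↔ x.1 ∈ τ := by
    intro x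
    simp only [T, Finset.mem_image, Finset.mem_attach, true_and, Subtype.exists]
    constructor
    · rintro ⟨a, ha, rfl⟩; exact ha
    · intro h; exact ⟨x.1, h, rfl⟩
  let a : E →ᵃ[ℝ] ℝ := ∑ i ∈ T, b.coord i
  have ha : ∀ x : s, a x.1 = if x.1 ∈ τ then 1 else 0 := by
    intro x
    have hx : x.1 = b x := by rw [hbs]
    have h1 : a x.1 = ∑ i ∈ T, b.coord i x.1 := by
      have : ∀ U : Finset s, (∑ i ∈ U, b.coord i) x.1 = ∑ i ∈ U, b.coord i x.1 := by
        intro U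
        induction U using Finset.induction_on with
        | empty => simp
        | insert i U hi ih => rw [Finset.sum_insert hi, Finset.sum_insert hi, ← ih]; rfl
      exact this T
    rw [h1]
    have h2 : ∀ i ∈ T, b.coord i x.1 = if i = x then 1 else 0 := by
      intro i _
      rw [hx, AffineBasis.coord_apply]
    rw [Finset.sum_congr rfl h2, Finset.sum_ite_eq' T x]
    simp only [hT]
  let m : StrongDual ℝ E := LinearMap.toContinuousLinearMap a.linear
  have hm : ∀ x, m x = a x - a 0 := by
    intro x
    have := a.linearMap_vsub x 0
    simpa [m] using this
  have haτ : ∀ x ∈ τ, a x = 1 := fun x hx => by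
    have := ha ⟨x, hs (hτ hx)⟩
    simpa [hx] using this
  have haF : ∀ x ∈ (P.verts : Set E) ∩ F, x ∉ τ → a x = 0 := fun x hx hxτ => by
    have := ha ⟨x, hs hx⟩
    simpa [hxτ] using this
  obtain ⟨ε, hε, hεlt⟩ : ∃ ε : ℝ, 0 < ε ∧ ∀ y ∈ P.verts, y ∉ F →
      l y + ε * a y < l t₀ + ε := by
    have hev : ∀ y ∈ P.verts, ∀ᶠ ε : ℝ in nhdsWithin 0 (Set.Ioi 0),
        y ∉ F → l y + ε * a y < l t₀ + ε := by
      intro y hy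
      by_cases hyF : y ∈ F
      · exact Filter.Eventually.of_forall fun _ h => absurd hyF h
      have hlt : l y < l t₀ := by
        by_contra hge
        apply hyF
        rw [hl]
        exact ⟨hsub hy, fun z hz => (hFmax t₀ (hτ ht₀) z hz).trans (not_lt.1 hge)⟩
      have hc : Continuous fun ε : ℝ => (l t₀ + ε) - (l y + ε * a y) := by fun_prop
      have h0 : (0 : ℝ) < (fun ε : ℝ => (l t₀ + ε) - (l y + ε * a y)) 0 := by simpa using hlt
      have := (hc.tendsto 0).eventually (lt_mem_nhds h0)
      filter_upwards [nhdsWithin_le_nhds this] with ε hε _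
      linarith
    have hall := (Filter.eventually_all_finset P.verts).2 hev
    obtain ⟨ε, h1, h2⟩ := (hall.and self_mem_nhdsWithin).exists
    exact ⟨ε, h2, h1⟩
  let g : StrongDual ℝ E := l + ε • m
  have hg : ∀ x, g x = l x + ε * a x - ε * a 0 := by
    intro x
    simp only [g, add_apply, smul_apply, smul_eq_mul, hm]
    ring
  have hgτ : ∀ x ∈ τ, g x = l t₀ + ε - ε * a 0 := by
    intro x hx
    have h1 := hFmax x (hτ hx) t₀ (hsub (hτ ht₀).1)
    have h2 := hFmax t₀ (hτ ht₀) x (hsub (hτ hx).1)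
    rw [hg, haτ x hx, le_antisymm h2 h1]
    ring
  have hglt : ∀ y ∈ P.verts, y ∉ τ → g y < l t₀ + ε - ε * a 0 := by
    intro y hy hyτ
    rw [hg]
    by_cases hyF : y ∈ F
    · have h2 := hFmax t₀ (hτ ht₀) y (hsub hy)
      rw [haF y ⟨hy, hyF⟩ hyτ]
      linarith
    · have := hεlt y hy hyF
      linarith
  have hgle : ∀ y ∈ P.body, g y ≤ l t₀ + ε - ε * a 0 := by
    have hconv : Convex ℝ {y : E | g y ≤ l t₀ + ε - ε * a 0} :=
      convex_halfSpace_le g.toLinearMap.isLinear _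
    intro y hy
    refine convexHull_min ?_ hconv hy
    intro z hz
    by_cases hzτ : z ∈ τ
    · exact (hgτ z hzτ).le
    · exact (hglt z hz hzτ).le
  have hmem : (τ : Set E) = (P.verts : Set E) ∩ {x ∈ P.body | ∀ y ∈ P.body, g y ≤ g x} := by
    ext x
    constructor
    · intro hx
      refine ⟨(hτ hx).1, hsub (hτ hx).1, fun y hy => ?_⟩
      rw [hgτ x hx]
      exact hgle y hy
    · rintro ⟨hxV, -, hx⟩
      by_contra hxτ
      have h1 := hx t₀ (hsub (hτ ht₀).1)
      rw [hgτ t₀ ht₀] at h1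
      exact absurd (hglt x hxV hxτ) (not_lt.2 h1)
  refine ⟨_, ⟨fun _ => ⟨g, rfl⟩, ?_⟩, hmem⟩
  intro heq
  rw [heq, Set.inter_eq_left.2 hsub] at hmem
  apply hF.2
  refine Set.Subset.antisymm (by rw [hl]; exact Set.sep_subset _ _) ?_
  intro x hx
  rw [hl]
  refine ⟨hx, fun y hy => (hFmax t₀ (hτ ht₀) y hy).trans ?_⟩
  have hconv : Convex ℝ {y : E | l t₀ ≤ l y} := convex_halfSpace_ge l.toLinearMap.isLinear _
  refine convexHull_min ?_ hconv hx
  intro z hz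
  rw [← hmem] at hz
  exact hFmax z (hτ hz) t₀ (hsub (hτ ht₀).1)

open scoped Classical in
/-- The boundary complex `∂P`: its faces are the vertex sets of the proper faces of `P`. -/
def boundaryComplex [FiniteDimensional ℝ E] (P : SimplicialPolytope E) :
    FinSimplicialComplex E where
  faces := P.verts.powerset.filter fun σ =>
    ∃ F : Set E, IsProperFace P.body F ∧ (σ : Set E) = (P.verts : Set E) ∩ F
  down_closed := by
    intro σ hσ τ hτσ
    rw [Finset.mem_filter, Finset.mem_powerset] at hσ ⊢
    obtain ⟨hσV, F, hF, hσF⟩ := hσ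
    refine ⟨hτσ.trans hσV, P.exists_properFace_of_subset hF ?_⟩
    rw [← hσF]
    exact_mod_cast hτσ

/-- `P` is balanced: with `d = dim P`, the graph of its boundary complex is properly
`d`-colorable. -/
def IsBalanced [FiniteDimensional ℝ E] (P : SimplicialPolytope E) : Prop :=
  P.boundaryComplex.graph.Colorable P.dim

end SimplicialPolytope

end

/-! Translate P so that the origin is interior, and let W be the direction of its affine hull. The
vertices of each facet F then form a basis of W. For a generic vector y let R F consist of the
vertices of F at which y has a positive coordinate. On the polar polytope, y and -y each attain
their maximum over the dual face of σ at a single vertex, that is, at a single facet containing σ.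
For -y this says that the intervals [R F, F] partition the faces of Δ, and for y that the intervals
[F \ R F, F] do (`exists_isPartitioning`). An interval with d-element upper end contributes X^|R F|
to the h-polynomial, so h_Δ is the sum of X^|R F|, and also of X^(d - |R F|), over all facets.

Given a vertex v, take y close to -v, so that v lies in no R F. Both partitionings restrict to the
link of v and show that (1 + X) h_lk(v) is the sum of X^|R F| + X^(d - |R F|) over the facets
through v. Balancedness enters next: each facet has exactly one vertex of the colour c of v, and
both partitionings also restrict to the complex of faces avoiding c. Comparing them shows that h_Δ
is the sum of the same terms over all facets whose R F avoids c (`hPoly_eq_sum_avoiding_color`).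
Facets through v are among these, whence (1 + X) h_lk(v) ≤ h_Δ, and summing over v gives (1).

For (2), counting pairs v ∈ F expresses the sum of the link polynomials through the h-numbers of Δ
(`sum_coeff_hPoly_link`); with h_1 = f_0 - d, comparing coefficients in (1) is exactly (2). -/

open Module Filter Topology

/-! ### Interval partitions of set families -/

namespace Finset

variable {α : Type*} [DecidableEq α]

/-- After factoring out x^|L|, the binomial expansion of (x + (1 - x))^n remains, with n = |U \ L|.
-/
theorem sum_Icc_pow_card_mul_pow {A : Type*} [CommRing A] (x : A) {L U : Finset α} (h : L ⊆ U) :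
    ∑ σ ∈ Icc L U, x ^ σ.card * (1 - x) ^ (U.card - σ.card) = x ^ L.card := by
  have hinj : Set.InjOn (L ∪ ·) ((U \ L).powerset : Set (Finset α)) := by
    intro s hs t ht hst
    have hs' := mem_powerset.1 hs
    have ht' := mem_powerset.1 ht
    ext a
    have h1 := Finset.ext_iff.1 hst a
    have h2 := @hs' a
    have h3 := @ht' a
    simp only [mem_union, mem_sdiff] at h1 h2 h3
    tauto
  rw [Icc_eq_image_powerset h, sum_image hinj]
  have h1 : ∀ τ ∈ (U \ L).powerset,
      x ^ (L ∪ τ).card * (1 - x) ^ (U.card - (L ∪ τ).card) =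
        x ^ L.card * (x ^ τ.card * (1 - x) ^ ((U \ L).card - τ.card)) := by
    intro τ hτ
    have hd : Disjoint L τ := disjoint_of_subset_right (mem_powerset.1 hτ) disjoint_sdiff
    rw [card_union_of_disjoint hd, card_sdiff_of_subset h, pow_add, Nat.sub_add_eq, mul_assoc]
  rw [sum_congr rfl h1, ← mul_sum, sum_pow_mul_eq_add_pow]
  simp

/-- If a family of finite sets is partitioned into the intervals `[L F, U F]`, whose upper ends have
`r` elements, then its `h`-polynomial counts the lower ends by size. -/
theorem sum_pow_card_mul_pow_of_partition {A ι : Type*} [CommRing A] (x : A)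
    (𝓕 : Finset (Finset α)) (I : Finset ι) (L U : ι → Finset α) (r : ℕ)
    (hLU : ∀ F ∈ I, L F ⊆ U F) (hU : ∀ F ∈ I, (U F).card = r)
    (hmem : ∀ F ∈ I, ∀ σ, L F ⊆ σ → σ ⊆ U F → σ ∈ 𝓕)
    (hex : ∀ σ ∈ 𝓕, ∃! F, F ∈ I ∧ L F ⊆ σ ∧ σ ⊆ U F) :
    ∑ σ ∈ 𝓕, x ^ σ.card * (1 - x) ^ (r - σ.card) = ∑ F ∈ I, x ^ (L F).card := by
  have h1 : ∀ F ∈ I, x ^ (L F).card =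
      ∑ σ ∈ Icc (L F) (U F), x ^ σ.card * (1 - x) ^ (r - σ.card) := by
    intro F hF
    rw [← sum_Icc_pow_card_mul_pow x (hLU F hF), hU F hF]
  have h2 : ∀ σ ∈ 𝓕, x ^ σ.card * (1 - x) ^ (r - σ.card) =
      ∑ F ∈ I.filter (fun F => L F ⊆ σ ∧ σ ⊆ U F), x ^ σ.card * (1 - x) ^ (r - σ.card) := by
    intro σ hσ
    obtain ⟨F, hF, huniq⟩ := hex σ hσ
    rw [sum_const, card_eq_one.2 ⟨F, ?_⟩, one_smul]
    ext G
    rw [mem_filter, mem_singleton]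
    exact ⟨huniq G, fun h => h ▸ hF⟩
  rw [sum_congr rfl h1, sum_congr rfl h2]
  apply sum_comm'
  intro σ F
  simp only [mem_filter, mem_Icc]
  exact ⟨fun h => ⟨h.2.2, h.2.1⟩, fun h => ⟨hmem F h.2 σ h.1.1 h.1.2, h.2, h.1⟩⟩

end Finset

/-! ### The h-polynomial as a sum over faces -/

namespace FinSimplicialComplex

variable {α : Type*} (Δ : FinSimplicialComplex α)

theorem card_le_rank {σ : Finset α} (h : σ ∈ Δ.faces) : σ.card ≤ Δ.rank :=
  Finset.le_sup (f := Finset.card) h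

theorem hPoly_eq_sum_faces :
    Δ.hPoly = ∑ σ ∈ Δ.faces, X ^ σ.card * (1 - X : ℤ[X]) ^ (Δ.rank - σ.card) := by
  have hmaps : ∀ σ ∈ Δ.faces, σ.card ∈ Finset.range (Δ.rank + 1) := fun σ hσ =>
    Finset.mem_range.2 (Nat.lt_succ_of_le (Δ.card_le_rank hσ))
  rw [← Finset.sum_fiberwise_of_maps_to hmaps, hPoly]
  refine Finset.sum_congr rfl fun j _ => ?_
  rw [Finset.sum_congr rfl (g := fun _ => X ^ j * (1 - X : ℤ[X]) ^ (Δ.rank - j))]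
  · rw [Finset.sum_const, numFaces, nsmul_eq_mul, mul_assoc]
    simp
  · intro σ hσ
    rw [(Finset.mem_filter.1 hσ).2]

open scoped Classical in
theorem mem_link_singleton {v : α} {τ : Finset α} :
    τ ∈ (Δ.link {v}).faces ↔ insert v τ ∈ Δ.faces ∧ v ∉ τ := by
  simp only [link, Finset.mem_filter, Finset.disjoint_singleton_left, Finset.singleton_union]
  exact ⟨fun h => h.2, fun h => ⟨Δ.down_closed _ h.1 _ (Finset.subset_insert _ _), h⟩⟩

theorem card_vertices : Δ.vertices.card = Δ.numFaces 1 := by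
  classical
  rw [numFaces]
  refine Finset.card_bij (fun v _ => {v}) ?_ ?_ ?_
  · intro v hv
    rw [Finset.mem_filter]
    exact ⟨(Δ.mem_vertices v).1 hv, Finset.card_singleton v⟩
  · intro v _ u _ h
    exact Finset.singleton_injective h
  · intro σ hσ
    obtain ⟨h1, h2⟩ := Finset.mem_filter.1 hσ
    obtain ⟨v, rfl⟩ := Finset.card_eq_one.1 h2
    exact ⟨v, (Δ.mem_vertices v).2 h1, rfl⟩

/-- The first `h`-number: `h_1 = f_0 - r`, where `r = dim Δ + 1`. -/
theorem coeff_one_hPoly (h : ∅ ∈ Δ.faces) :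
    Δ.hPoly.coeff 1 = (Δ.numFaces 1 : ℤ) - Δ.rank := by
  have h0 : Δ.numFaces 0 = 1 := by
    rw [numFaces, Finset.card_eq_one]
    refine ⟨∅, ?_⟩
    ext σ
    simp only [Finset.mem_filter, Finset.card_eq_zero, Finset.mem_singleton]
    exact ⟨fun h => h.2, fun hσ => ⟨hσ ▸ h, hσ⟩⟩
  have hd : ∀ n : ℕ, ((1 - X : ℤ[X]) ^ n).coeff 1 = -(n : ℤ) := by
    intro n
    induction n with
    | zero => simp [coeff_one]
    | succ n ih =>
      rw [pow_succ, mul_sub, mul_one, coeff_sub, ih, coeff_mul_X, coeff_zero_eq_eval_zero]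
      simp
      ring
  have hterm : ∀ j, (C (Δ.numFaces j : ℤ) * X ^ j * (1 - X) ^ (Δ.rank - j)).coeff 1 =
      if j = 0 then -(Δ.rank : ℤ) else if j = 1 then (Δ.numFaces 1 : ℤ) else 0 := by
    intro j
    rw [mul_assoc, coeff_C_mul, coeff_X_pow_mul']
    rcases j with _ | _ | j
    · simp [h0, hd]
    · simp [coeff_zero_eq_eval_zero]
    · simp
  rw [hPoly, finsetSum_coeff, Finset.sum_congr rfl fun j _ => hterm j]
  rcases hr : Δ.rank with _ | r
  · have : Δ.numFaces 1 = 0 := by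
      rw [numFaces, Finset.card_eq_zero, Finset.filter_eq_empty_iff]
      intro σ hσ h1
      have := Δ.card_le_rank hσ
      omega
    simp [this]
  · rw [Finset.sum_range_succ', Finset.sum_range_succ', Finset.sum_eq_zero]
    · simp; ring
    · intro j _
      simp

/-- `R` assigns to each face with `d` elements a subset of it, and the intervals `[R F, F]`
partition the faces. -/
structure IsPartitioning (d : ℕ) (R : Finset α → Finset α) : Prop where
  subset : ∀ F, R F ⊆ F
  existsUnique : ∀ σ ∈ Δ.faces, ∃! F, (F ∈ Δ.faces ∧ F.card = d) ∧ R F ⊆ σ ∧ σ ⊆ F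

/-- The faces with `d` elements. -/
def facets (d : ℕ) : Finset (Finset α) := Δ.faces.filter fun F => F.card = d

variable {Δ} {d : ℕ} {R : Finset α → Finset α}

theorem mem_facets {F : Finset α} : F ∈ Δ.facets d ↔ F ∈ Δ.faces ∧ F.card = d := Finset.mem_filter

/-! ### h-polynomials of partitioned complexes, links and colour-avoiding subcomplexes -/

namespace IsPartitioning

theorem existsUnique_facets (h : Δ.IsPartitioning d R) {σ : Finset α} (hσ : σ ∈ Δ.faces) :
    ∃! F, F ∈ Δ.facets d ∧ R F ⊆ σ ∧ σ ⊆ F := by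
  simpa only [mem_facets] using h.existsUnique σ hσ

theorem exists_facet (h : Δ.IsPartitioning d R) {σ : Finset α} (hσ : σ ∈ Δ.faces) :
    ∃ F ∈ Δ.facets d, σ ⊆ F := by
  obtain ⟨F, hF, -⟩ := h.existsUnique_facets hσ
  exact ⟨F, hF.1, hF.2.2⟩

theorem card_le (h : Δ.IsPartitioning d R) {σ : Finset α} (hσ : σ ∈ Δ.faces) : σ.card ≤ d := by
  obtain ⟨F, hF, hσF⟩ := h.exists_facet hσ
  exact (Finset.card_le_card hσF).trans (mem_facets.1 hF).2.le

theorem rank_eq (h : Δ.IsPartitioning d R) (h0 : ∅ ∈ Δ.faces) : Δ.rank = d := by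
  refine le_antisymm (Finset.sup_le fun σ hσ => h.card_le hσ) ?_
  obtain ⟨F, hF, -⟩ := h.exists_facet h0
  rw [mem_facets] at hF
  exact hF.2 ▸ Δ.card_le_rank hF.1

theorem hPoly_eq (h : Δ.IsPartitioning d R) (h0 : ∅ ∈ Δ.faces) :
    Δ.hPoly = ∑ F ∈ Δ.facets d, X ^ (R F).card := by
  classical
  rw [hPoly_eq_sum_faces, h.rank_eq h0]
  refine Finset.sum_pow_card_mul_pow_of_partition X Δ.faces (Δ.facets d) R id d
    (fun F _ => h.subset F) (fun F hF => (mem_facets.1 hF).2) ?_ ?_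
  · intro F hF σ _ hσ
    exact Δ.down_closed F (mem_facets.1 hF).1 σ hσ
  · intro σ hσ
    exact h.existsUnique_facets hσ

open scoped Classical in
theorem rank_link (h : Δ.IsPartitioning d R) {v : α} (hv : v ∈ Δ.vertices) :
    (Δ.link {v}).rank = d - 1 := by
  refine le_antisymm (Finset.sup_le fun τ hτ => ?_) ?_
  · rw [mem_link_singleton] at hτ
    have := h.card_le hτ.1
    rw [Finset.card_insert_of_notMem hτ.2] at this
    omega
  · obtain ⟨F, hF, hvF⟩ := h.exists_facet ((Δ.mem_vertices v).1 hv)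
    rw [mem_facets] at hF
    rw [Finset.singleton_subset_iff] at hvF
    rw [← hF.2, ← Finset.card_erase_of_mem hvF]
    refine card_le_rank _ ((Δ.mem_link_singleton).2 ⟨?_, Finset.notMem_erase v F⟩)
    rw [Finset.insert_erase hvF]
    exact hF.1

open scoped Classical in
-- Faces of the link are the faces through v with v deleted. Only intervals with v ∈ F contain faces
-- through v, and deleting v turns them into intervals partitioning the link.
theorem hPoly_link_eq (h : Δ.IsPartitioning d R) {v : α} (hv : v ∈ Δ.vertices) :
    (Δ.link {v}).hPoly =
      ∑ F ∈ (Δ.facets d).filter (v ∈ ·), X ^ ((R F).erase v).card := by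
  rw [hPoly_eq_sum_faces, h.rank_link hv]
  refine Finset.sum_pow_card_mul_pow_of_partition X (Δ.link {v}).faces _ (fun F => (R F).erase v)
    (fun F => F.erase v) (d - 1) (fun F _ => Finset.erase_subset_erase v (h.subset F)) ?_ ?_ ?_
  · intro F hF
    rw [Finset.mem_filter, mem_facets] at hF
    rw [Finset.card_erase_of_mem hF.2, hF.1.2]
  · intro F hF σ _ hσ
    rw [Finset.mem_filter, mem_facets] at hF
    rw [mem_link_singleton]
    refine ⟨Δ.down_closed F hF.1.1 _ ?_, fun hvσ => Finset.notMem_erase v F (hσ hvσ)⟩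
    exact Finset.insert_subset hF.2 (hσ.trans (Finset.erase_subset v F))
  · intro σ hσ
    rw [mem_link_singleton] at hσ
    obtain ⟨F, ⟨hF, h1, h2⟩, huniq⟩ := h.existsUnique_facets hσ.1
    rw [Finset.insert_subset_iff] at h2
    refine ⟨F, ⟨Finset.mem_filter.2 ⟨hF, h2.1⟩, ?_, ?_⟩, ?_⟩
    · rwa [← Finset.subset_insert_iff]
    · exact Finset.subset_erase.2 ⟨h2.2, hσ.2⟩
    · rintro G ⟨hG, h3, h4⟩
      rw [Finset.mem_filter] at hG
      exact huniq G ⟨hG.1, Finset.subset_insert_iff.2 h3,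
        Finset.insert_subset hG.2 (h4.trans (Finset.erase_subset v G))⟩

theorem exists_mem_color_eq {κ : Type*} [Fintype κ] (hκ : Fintype.card κ = d) {col : α → κ}
    (hcol : ∀ F ∈ Δ.faces, Set.InjOn col F) {F : Finset α} (hF : F ∈ Δ.facets d) (c : κ) :
    ∃ u ∈ F, col u = c := by
  classical
  rw [mem_facets] at hF
  have : F.image col = Finset.univ := by
    rw [← Finset.card_eq_iff_eq_univ, Finset.card_image_of_injOn (hcol F hF.1), hF.2, hκ]
  simpa using this.ge (Finset.mem_univ c)

open scoped Classical in
/-- In a balanced complex, the `h`-polynomial of the complex of faces that avoid a colour. -/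
theorem sum_avoiding_color {κ : Type*} [Fintype κ] (hκ : Fintype.card κ = d)
    (h : Δ.IsPartitioning d R) {col : α → κ}
    (hcol : ∀ F ∈ Δ.faces, Set.InjOn col F) (c : κ) :
    ∑ σ ∈ Δ.faces.filter (fun σ => ∀ u ∈ σ, col u ≠ c),
        X ^ σ.card * (1 - X : ℤ[X]) ^ (d - 1 - σ.card) =
      ∑ F ∈ (Δ.facets d).filter (fun F => ∀ u ∈ R F, col u ≠ c), X ^ (R F).card := by
  refine Finset.sum_pow_card_mul_pow_of_partition X _ _ R
    (fun F => F.filter fun u => col u ≠ c) (d - 1) ?_ ?_ ?_ ?_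
  · intro F hF u hu
    exact Finset.mem_filter.2 ⟨h.subset F hu, (Finset.mem_filter.1 hF).2 u hu⟩
  · intro F hF
    rw [Finset.mem_filter] at hF
    obtain ⟨u, hu, hc⟩ := exists_mem_color_eq hκ hcol hF.1 c
    have hFf := mem_facets.1 hF.1
    have : (F.filter fun u => col u ≠ c) = F.erase u := by
      ext x
      simp only [Finset.mem_filter, Finset.mem_erase]
      constructor
      · rintro ⟨hx, hxc⟩
        exact ⟨fun hxu => hxc (hxu ▸ hc), hx⟩
      · rintro ⟨hxu, hx⟩
        exact ⟨hx, fun hxc => hxu (hcol F hFf.1 hx hu (hxc.trans hc.symm))⟩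
    rw [this, Finset.card_erase_of_mem hu, hFf.2]
  · intro F hF σ _ hσ
    rw [Finset.mem_filter, mem_facets] at hF
    refine Finset.mem_filter.2 ⟨Δ.down_closed F hF.1.1 σ (hσ.trans (Finset.filter_subset _ _)), ?_⟩
    intro u hu
    exact (Finset.mem_filter.1 (hσ hu)).2
  · intro σ hσ
    rw [Finset.mem_filter] at hσ
    obtain ⟨F, ⟨hF, h1, h2⟩, huniq⟩ := h.existsUnique_facets hσ.1
    refine ⟨F, ⟨Finset.mem_filter.2 ⟨hF, fun u hu => hσ.2 u (h1 hu)⟩, h1, ?_⟩, ?_⟩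
    · intro u hu
      exact Finset.mem_filter.2 ⟨h2 hu, hσ.2 u hu⟩
    · rintro G ⟨hG, h3, h4⟩
      exact huniq G ⟨(Finset.mem_filter.1 hG).1, h3, h4.trans (Finset.filter_subset _ _)⟩

open scoped Classical in
theorem card_compl (h : Δ.IsPartitioning d R) {F : Finset α} (hF : F ∈ Δ.facets d) :
    (F \ R F).card = d - (R F).card := by
  rw [Finset.card_sdiff_of_subset (h.subset F), (mem_facets.1 hF).2]

open scoped Classical in
/-- The `h`-polynomial of a balanced complex, counting only facets whose lower end avoids a given
colour. -/
theorem hPoly_eq_sum_avoiding_color {κ : Type*} [Fintype κ] (hκ : Fintype.card κ = d)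
    (h : Δ.IsPartitioning d R) (h' : Δ.IsPartitioning d fun F => F \ R F) (h0 : ∅ ∈ Δ.faces)
    {col : α → κ} (hcol : ∀ F ∈ Δ.faces, Set.InjOn col F) (c : κ) :
    Δ.hPoly = ∑ F ∈ (Δ.facets d).filter (fun F => ∀ u ∈ R F, col u ≠ c),
      (X ^ (R F).card + X ^ (d - (R F).card)) := by
  -- F has exactly one vertex of colour c, and it lies in exactly one of R F and F \ R F.
  have hiff : ∀ F ∈ Δ.facets d, (¬ ∀ u ∈ F \ R F, col u ≠ c) ↔ ∀ u ∈ R F, col u ≠ c := by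
    intro F hF
    obtain ⟨u, hu, hc⟩ := exists_mem_color_eq hκ hcol hF c
    have hinj := hcol F (mem_facets.1 hF).1
    constructor
    · intro hn x hx hxc
      apply hn
      intro y hy hyc
      rw [Finset.mem_sdiff] at hy
      have := hinj hy.1 (h.subset F hx) (hyc.trans hxc.symm)
      exact hy.2 (this ▸ hx)
    · intro hn hall
      by_cases huR : u ∈ R F
      · exact hn u huR hc
      · exact hall u (Finset.mem_sdiff.2 ⟨hu, huR⟩) hc
  -- Both partitionings evaluate the same sum over faces avoiding c, so the two sums over lower ends
  -- avoiding c may be exchanged.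
  rw [Finset.sum_add_distrib, ← h.sum_avoiding_color hκ hcol c, h'.sum_avoiding_color hκ hcol c,
    h'.hPoly_eq h0, ← Finset.sum_filter_add_sum_filter_not (Δ.facets d)
      (fun F => ∀ u ∈ F \ R F, col u ≠ c)]
  congr 1
  rw [Finset.filter_congr hiff]
  refine Finset.sum_congr rfl fun F hF => ?_
  rw [h.card_compl (Finset.mem_filter.1 hF).1]

open scoped Classical in
/-- The suspension of the link of a vertex `v` of a balanced complex has smaller `h`-numbers, if
`v` is never in the lower end of an interval. -/
theorem coeff_hPoly_link_le {κ : Type*} [Fintype κ] (hκ : Fintype.card κ = d)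
    (h : Δ.IsPartitioning d R) (h' : Δ.IsPartitioning d fun F => F \ R F) (h0 : ∅ ∈ Δ.faces)
    {col : α → κ} (hcol : ∀ F ∈ Δ.faces, Set.InjOn col F) {v : α} (hv : v ∈ Δ.vertices)
    (hvR : ∀ F ∈ Δ.facets d, v ∉ R F) (k : ℕ) :
    ((1 + X) * (Δ.link {v}).hPoly).coeff k ≤ Δ.hPoly.coeff k := by
  have h1 : (Δ.link {v}).hPoly = ∑ F ∈ (Δ.facets d).filter (v ∈ ·), X ^ (R F).card := by
    rw [h.hPoly_link_eq hv]
    refine Finset.sum_congr rfl fun F hF => ?_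
    rw [Finset.erase_eq_of_notMem (hvR F (Finset.mem_filter.1 hF).1)]
  -- In the opposite partitioning v is in the lower end of every facet through v; deleting it costs
  -- one degree, which the factor X restores.
  have h2 : X * (Δ.link {v}).hPoly =
      ∑ F ∈ (Δ.facets d).filter (v ∈ ·), X ^ (d - (R F).card) := by
    rw [h'.hPoly_link_eq hv, Finset.mul_sum]
    refine Finset.sum_congr rfl fun F hF => ?_
    rw [Finset.mem_filter] at hF
    have hvm : v ∈ F \ R F := Finset.mem_sdiff.2 ⟨hF.2, hvR F hF.1⟩
    rw [← pow_succ', Finset.card_erase_add_one hvm, h.card_compl hF.1]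
  rw [add_mul, one_mul, h2, h1, ← Finset.sum_add_distrib,
    h.hPoly_eq_sum_avoiding_color hκ h' h0 hcol (col v), finsetSum_coeff, finsetSum_coeff]
  refine Finset.sum_le_sum_of_subset_of_nonneg ?_ ?_
  · intro F hF
    rw [Finset.mem_filter] at hF ⊢
    -- The only vertex of F with the colour of v is v itself, which is not in R F.
    refine ⟨hF.1, fun u hu hc => hvR F hF.1 ?_⟩
    rwa [← hcol F (mem_facets.1 hF.1).1 (h.subset F hu) hF.2 hc]
  · intro F _ _
    rw [coeff_add, coeff_X_pow, coeff_X_pow]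
    positivity

theorem coeff_hPoly_eq (h : Δ.IsPartitioning d R) (h0 : ∅ ∈ Δ.faces) (k : ℕ) :
    Δ.hPoly.coeff k = ∑ F ∈ Δ.facets d, if (R F).card = k then 1 else 0 := by
  rw [h.hPoly_eq h0, finsetSum_coeff]
  refine Finset.sum_congr rfl fun F _ => ?_
  rw [coeff_X_pow]
  simp only [eq_comm]

open scoped Classical in
-- Double counting of pairs v ∈ F: a facet contributes X^|R F| for each of its d - |R F| vertices
-- outside R F, and X^(|R F| - 1) for each vertex of R F.
theorem sum_coeff_hPoly_link (h : Δ.IsPartitioning d R) (h0 : ∅ ∈ Δ.faces) (k : ℕ) :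
    (∑ v ∈ Δ.vertices, (Δ.link {v}).hPoly).coeff k =
      ((k : ℤ) + 1) * Δ.hPoly.coeff (k + 1) + ((d : ℤ) - k) * Δ.hPoly.coeff k := by
  have hsw : ∑ v ∈ Δ.vertices, (Δ.link {v}).hPoly =
      ∑ F ∈ Δ.facets d, ∑ v ∈ F, (X : ℤ[X]) ^ ((R F).erase v).card := by
    rw [Finset.sum_congr rfl fun v hv => h.hPoly_link_eq hv]
    refine Finset.sum_comm' fun v F => ?_
    rw [Finset.mem_filter]
    refine ⟨fun hx => ⟨hx.2.2, hx.2.1⟩, fun hx => ⟨?_, hx.2, hx.1⟩⟩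
    rw [mem_vertices]
    exact Δ.down_closed F (mem_facets.1 hx.2).1 _ (Finset.singleton_subset_iff.2 hx.1)
  have hF : ∀ F ∈ Δ.facets d, (∑ v ∈ F, (X : ℤ[X]) ^ ((R F).erase v).card).coeff k =
      ((k : ℤ) + 1) * (if (R F).card = k + 1 then 1 else 0) +
        ((d : ℤ) - k) * (if (R F).card = k then 1 else 0) := by
    intro F hF
    have hsub := h.subset F
    rw [← Finset.sum_sdiff hsub,
      Finset.sum_congr rfl (g := fun _ => (X : ℤ[X]) ^ (R F).card) fun v hv => by
        rw [Finset.erase_eq_of_notMem (Finset.mem_sdiff.1 hv).2],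
      Finset.sum_congr (s₁ := R F) rfl (g := fun _ => (X : ℤ[X]) ^ ((R F).card - 1)) fun v hv => by
        rw [Finset.card_erase_of_mem hv],
      Finset.sum_const, Finset.sum_const, h.card_compl hF, coeff_add, coeff_smul, coeff_smul,
      coeff_X_pow, coeff_X_pow]
    have hle : (R F).card ≤ d := (mem_facets.1 hF).2 ▸ Finset.card_le_card hsub
    generalize (R F).card = m at *
    rcases m with _ | m
    · rcases k with _ | k <;> simp
    · rw [nsmul_eq_mul, nsmul_eq_mul, Nat.cast_sub hle]
      by_cases h1 : k = m + 1
      · subst h1; simp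
      · by_cases h2 : k = m
        · subst h2; simp
        · simp [h1, h2, Ne.symm h1, Ne.symm h2]
  rw [hsw, finsetSum_coeff, Finset.sum_congr rfl hF, Finset.sum_add_distrib, ← Finset.mul_sum,
    ← Finset.mul_sum, ← h.coeff_hPoly_eq h0, ← h.coeff_hPoly_eq h0]

end IsPartitioning

/-- The coefficientwise inequality for the links gives the quadratic inequalities. -/
theorem hNum_le_of_coeff_le (h : Δ.IsPartitioning d R) (h0 : ∅ ∈ Δ.faces)
    (hle : ∀ k : ℕ, ((1 + X) * ∑ v ∈ Δ.vertices, (Δ.link {v}).hPoly).coeff k ≤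
      (C (Δ.numFaces 1 : ℤ) * Δ.hPoly).coeff k) (i : ℤ) :
    ((d : ℤ) - i + 1) * Δ.hNum (i - 1) + (i + 1) * Δ.hNum (i + 1) ≤ Δ.hNum 1 * Δ.hNum i := by
  have h1 : Δ.hNum 1 = (Δ.numFaces 1 : ℤ) - d := by
    have := Δ.coeff_one_hPoly h0
    rw [h.rank_eq h0] at this
    simpa [hNum] using this
  rcases lt_trichotomy i 0 with hi | rfl | hi
  · have e1 : Δ.hNum (i - 1) = 0 := if_neg (by omega)
    have e2 : Δ.hNum i = 0 := if_neg (by omega)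
    rw [e1, e2]
    -- At i = -1 the number h_0 does occur, but its coefficient i + 1 is zero.
    rcases eq_or_ne i (-1) with rfl | hne
    · simp
    · have e3 : Δ.hNum (i + 1) = 0 := if_neg (by omega)
      simp [e3]
  · have := hle 0
    rw [coeff_C_mul, mul_coeff_zero, h.sum_coeff_hPoly_link h0] at this
    have e1 : Δ.hNum (0 - 1) = 0 := if_neg (by omega)
    have e2 : Δ.hNum (0 + 1) = Δ.hPoly.coeff 1 := by simp [hNum]
    have e3 : Δ.hNum 0 = Δ.hPoly.coeff 0 := by simp [hNum]
    rw [e1, e2, h1, e3]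
    simp at this
    linarith
  · obtain ⟨k, rfl⟩ : ∃ k : ℕ, i = k + 1 := ⟨(i - 1).toNat, by omega⟩
    have := hle (k + 1)
    -- The link sums in degrees k + 1 and k contribute (d - (k + 1)) + (k + 1) = d times h_{k+1},
    -- which turns f_0 into h_1 = f_0 - d.
    rw [coeff_C_mul, add_mul, one_mul, coeff_add, coeff_X_mul, h.sum_coeff_hPoly_link h0,
      h.sum_coeff_hPoly_link h0] at this
    have e1 : Δ.hNum ((k : ℤ) + 1 - 1) = Δ.hPoly.coeff k := by simp [hNum]
    have e2 : Δ.hNum ((k : ℤ) + 1 + 1) = Δ.hPoly.coeff (k + 1 + 1) :=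
      if_pos (by omega : (0 : ℤ) ≤ (k : ℤ) + 1 + 1)
    have e3 : Δ.hNum ((k : ℤ) + 1) = Δ.hPoly.coeff (k + 1) :=
      if_pos (by omega : (0 : ℤ) ≤ (k : ℤ) + 1)
    rw [e1, e2, h1, e3]
    push_cast at this
    linarith

end FinSimplicialComplex

/-! ### Coordinates and generic vectors -/

section Functionals

variable {α W : Type*} [NormedAddCommGroup W] [NormedSpace ℝ W]

open scoped Classical in
/-- The coordinate functionals of a finite family that is a basis. -/
theorem exists_coordinate_functionals [FiniteDimensional ℝ W] {w : α → W} {F : Finset α}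
    (hF : LinearIndepOn ℝ w (F : Set α)) (hc : F.card = finrank ℝ W) :
    ∃ c : α → StrongDual ℝ W, (∀ u ∈ F, ∀ u' ∈ F, c u (w u') = if u = u' then 1 else 0) ∧
      ∀ z, ∑ u ∈ F, c u z • w u = z := by
  have hc' : Fintype.card (F : Set α) = finrank ℝ W := by simpa using hc
  let b : Basis (F : Set α) ℝ W :=
    Basis.mk hF (LinearIndependent.span_eq_top_of_card_eq_finrank' hF hc').ge
  have hb : ∀ x, b x = w x := fun x => Basis.mk_apply _ _ x
  refine ⟨fun u => if hu : u ∈ F then LinearMap.toContinuousLinearMap (b.coord ⟨u, hu⟩) else 0,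
    ?_, ?_⟩
  · intro u hu u' hu'
    have : w u' = b ⟨u', hu'⟩ := (hb ⟨u', hu'⟩).symm
    simp [hu, this, Finsupp.single_apply, eq_comm]
  · intro z
    rw [← Finset.sum_coe_sort F]
    conv_rhs => rw [← b.sum_repr z]
    refine Finset.sum_congr rfl fun x _ => ?_
    simp [hb]

/-- Near every point there is one at which none of finitely many nonzero functionals vanishes. -/
theorem exists_forall_ne_zero_and_neg {ι : Type*} [Finite ι] (f : ι → StrongDual ℝ W)
    (hf : ∀ i, f i ≠ 0) (p : W) : ∃ y, ∀ i, f i y ≠ 0 ∧ (f i p < 0 → f i y < 0) := by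
  obtain ⟨x, hx⟩ := Module.Dual.exists_forall_ne_zero_of_forall_exists
    (fun i => (f i : W →ₗ[ℝ] ℝ)) fun i => by
      by_contra! h
      exact hf i (ContinuousLinearMap.ext h)
  have hev : ∀ i, ∀ᶠ ε : ℝ in 𝓝[>] 0, f i (p + ε • x) ≠ 0 ∧ (f i p < 0 → f i (p + ε • x) < 0) := by
    intro i
    have hcont : Tendsto (fun ε : ℝ => f i (p + ε • x)) (𝓝[>] 0) (𝓝 (f i p)) := by
      have : Continuous fun ε : ℝ => f i (p + ε • x) := by fun_prop
      simpa using (this.tendsto 0).mono_left nhdsWithin_le_nhds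
    rcases lt_trichotomy (f i p) 0 with h | h | h
    · filter_upwards [hcont.eventually (gt_mem_nhds h)] with ε hε
      exact ⟨hε.ne, fun _ => hε⟩
    · filter_upwards [self_mem_nhdsWithin] with ε hε
      rw [map_add, h, zero_add, map_smul, smul_eq_mul]
      exact ⟨mul_ne_zero (ne_of_gt hε) (hx i), fun h' => absurd h' (lt_irrefl _)⟩
    · filter_upwards [hcont.eventually (lt_mem_nhds h)] with ε hε
      exact ⟨hε.ne', fun h' => absurd h' h.not_gt⟩
  obtain ⟨ε, hε⟩ := (eventually_all.2 hev).exists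
  exact ⟨_, hε⟩

end Functionals

/-- A realization of a simplicial complex as the boundary complex of a simplicial polytope with the
origin in its interior: the faces are the sets of points on proper faces, given by functionals with
maximum one, and each face is linearly independent. -/
structure IsPolytopal {α W : Type*} [NormedAddCommGroup W] [NormedSpace ℝ W]
    (Δ : FinSimplicialComplex α) (V : Finset α) (w : α → W) : Prop where
  bounded : ∃ B : ℝ, ∀ a : StrongDual ℝ W, (∀ v ∈ V, a (w v) ≤ 1) → ‖a‖ ≤ B
  mem_faces_iff : ∀ σ : Finset α, σ ∈ Δ.faces ↔ σ ⊆ V ∧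
    ∃ a : StrongDual ℝ W, (∀ v ∈ σ, a (w v) = 1) ∧ ∀ v ∈ V, v ∉ σ → a (w v) < 1
  linearIndepOn : ∀ σ ∈ Δ.faces, LinearIndepOn ℝ w (σ : Set α)

/-! ### Partitionings from the polar polytope -/

namespace IsPolytopal

variable {α W : Type*} [NormedAddCommGroup W] [NormedSpace ℝ W]
  {Δ : FinSimplicialComplex α} {V : Finset α} {w : α → W}

theorem empty_mem_faces (h : IsPolytopal Δ V w) : ∅ ∈ Δ.faces :=
  (h.mem_faces_iff ∅).2 ⟨Finset.empty_subset V, 0, by simp, by simp⟩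

/-- The dual face of `σ` in the polar polytope. -/
def dualFace (V : Finset α) (w : α → W) (σ : Finset α) : Set (StrongDual ℝ W) :=
  {a | (∀ v ∈ V, a (w v) ≤ 1) ∧ ∀ v ∈ σ, a (w v) = 1}

theorem isCompact_dualFace [FiniteDimensional ℝ W] (h : IsPolytopal Δ V w) (σ : Finset α) :
    IsCompact (dualFace V w σ) := by
  have : ProperSpace (StrongDual ℝ W) := FiniteDimensional.proper ℝ _
  obtain ⟨B, hB⟩ := h.bounded
  refine Metric.isCompact_of_isClosed_isBounded ?_
    (isBounded_iff_forall_norm_le.2 ⟨B, fun a ha => hB a ha.1⟩)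
  have h1 : dualFace V w σ = (⋂ v ∈ V, {a : StrongDual ℝ W | a (w v) ≤ 1}) ∩
      ⋂ v ∈ σ, {a : StrongDual ℝ W | a (w v) = 1} := by
    ext a
    simp [dualFace]
  rw [h1]
  refine IsClosed.inter (isClosed_biInter fun v _ => ?_) (isClosed_biInter fun v _ => ?_)
  · exact isClosed_le (by fun_prop) continuous_const
  · exact isClosed_eq (by fun_prop) continuous_const

/-- Small moves in a direction that does not increase the tight inequalities stay in the dual
face. -/
theorem eventually_add_smul_mem_dualFace {σ : Finset α} {a b : StrongDual ℝ W}
    (ha : a ∈ dualFace V w σ) (hb : ∀ v ∈ V, a (w v) = 1 → b (w v) ≤ 0)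
    (hbσ : ∀ v ∈ σ, b (w v) = 0) :
    ∀ᶠ ε : ℝ in 𝓝[>] 0, a + ε • b ∈ dualFace V w σ := by
  have h1 : ∀ v ∈ V, ∀ᶠ ε : ℝ in 𝓝[>] 0, (a + ε • b) (w v) ≤ 1 := by
    intro v hv
    simp only [add_apply, smul_apply, smul_eq_mul]
    rcases (ha.1 v hv).lt_or_eq with hlt | heq
    · have hcont : Continuous fun ε : ℝ => a (w v) + ε * b (w v) := by fun_prop
      have := (hcont.tendsto 0).mono_left (nhdsWithin_le_nhds (s := Set.Ioi 0))
      rw [zero_mul, add_zero] at this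
      filter_upwards [this.eventually (gt_mem_nhds hlt)] with ε hε using hε.le
    · filter_upwards [self_mem_nhdsWithin] with ε hε
      have := mul_nonpos_of_nonneg_of_nonpos (le_of_lt hε) (hb v hv heq)
      linarith
  filter_upwards [(eventually_all_finset V).2 h1] with ε hε
  refine ⟨hε, fun v hv => ?_⟩
  simp [ha.2 v hv, hbσ v hv]

/-- Every vector is, up to the span of a face `σ`, in the cone of a facet that contains `σ`. -/
theorem exists_facet_forall_nonneg [FiniteDimensional ℝ W] (h : IsPolytopal Δ V w)
    {σ : Finset α} (hσ : σ ∈ Δ.faces) (z : W) : ∃ F ∈ Δ.faces, F.card = finrank ℝ W ∧ σ ⊆ F ∧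
      ∀ u ∈ F, u ∉ σ → ∀ b : StrongDual ℝ W, b (w u) = 1 → (∀ v ∈ F, v ≠ u → b (w v) = 0) →
        0 ≤ b z := by
  classical
  let ev : StrongDual ℝ (StrongDual ℝ W) := ContinuousLinearMap.apply ℝ ℝ z
  -- M is the face of the dual face on which evaluation at z is maximal; an extreme point of M is a
  -- vertex of the polar polytope, so its tight set F is a facet.
  let M : Set (StrongDual ℝ W) := {a ∈ dualFace V w σ | ∀ b ∈ dualFace V w σ, ev b ≤ ev a}
  have hM : IsExposed ℝ (dualFace V w σ) M := fun _ => ⟨ev, rfl⟩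
  have hMc : IsCompact M := hM.isCompact (h.isCompact_dualFace σ)
  have hne : (dualFace V w σ).Nonempty := by
    obtain ⟨-, a, h1, h2⟩ := (h.mem_faces_iff σ).1 hσ
    refine ⟨a, fun v hv => ?_, h1⟩
    by_cases hvσ : v ∈ σ
    · exact (h1 v hvσ).le
    · exact (h2 v hv hvσ).le
  have hMne : M.Nonempty := by
    obtain ⟨a, ha, hmax⟩ :=
      (h.isCompact_dualFace σ).exists_isMaxOn hne ev.continuous.continuousOn
    exact ⟨a, ha, hmax⟩
  obtain ⟨a, haM⟩ := hMc.extremePoints_nonempty hMne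
  rw [mem_extremePoints] at haM
  obtain ⟨⟨ha, hmax⟩, hext⟩ := haM
  have hσV := ((h.mem_faces_iff σ).1 hσ).1
  let F := V.filter fun v => a (w v) = 1
  have hFmem : ∀ v, v ∈ F ↔ v ∈ V ∧ a (w v) = 1 := fun v => Finset.mem_filter
  have hσF : σ ⊆ F := fun v hv => (hFmem v).2 ⟨hσV hv, ha.2 v hv⟩
  have hF : F ∈ Δ.faces := by
    refine (h.mem_faces_iff F).2 ⟨Finset.filter_subset _ _, a, fun v hv => ((hFmem v).1 hv).2, ?_⟩
    intro v hv hvF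
    exact lt_of_le_of_ne (ha.1 v hv) fun heq => hvF ((hFmem v).2 ⟨hv, heq⟩)
  -- Such b are feasible directions at a, along which the maximized evaluation cannot increase.
  have hnonpos : ∀ b : StrongDual ℝ W, (∀ v ∈ F, b (w v) ≤ 0) → (∀ v ∈ σ, b (w v) = 0) →
      b z ≤ 0 := by
    intro b hb hbσ
    obtain ⟨ε, hε, hpos⟩ := ((eventually_add_smul_mem_dualFace ha
      (fun v hv hav => hb v ((hFmem v).2 ⟨hv, hav⟩)) hbσ).and self_mem_nhdsWithin).exists
    have h1 : a z + ε * b z ≤ a z := hmax _ hε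
    by_contra hlt
    have := mul_pos hpos (not_le.1 hlt)
    linarith
  -- A nonzero functional vanishing on F would allow moving from a both ways inside M, contradicting
  -- extremality.
  have hspan : Submodule.span ℝ (w '' F) = ⊤ := by
    by_contra hlt
    obtain ⟨f, hf0, hf⟩ := Submodule.exists_le_ker_of_lt_top _ (lt_top_iff_ne_top.2 hlt)
    let b : StrongDual ℝ W := LinearMap.toContinuousLinearMap f
    have hb : ∀ v ∈ F, b (w v) = 0 := fun v hv =>
      hf (Submodule.subset_span (Set.mem_image_of_mem w hv))
    have hbz : b z = 0 := by
      refine le_antisymm (hnonpos b (fun v hv => (hb v hv).le) fun v hv => hb v (hσF hv)) ?_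
      have := hnonpos (-b) (fun v hv => by simp [hb v hv]) fun v hv => by simp [hb v (hσF hv)]
      simpa using this
    have hmem : ∀ v ∈ V, a (w v) = 1 → v ∈ F := fun v hv hav => (hFmem v).2 ⟨hv, hav⟩
    obtain ⟨ε, ⟨h1, h2⟩, hpos⟩ := (((eventually_add_smul_mem_dualFace ha
      (b := b) (fun v hv hav => (hb v (hmem v hv hav)).le) fun v hv => hb v (hσF hv)).and
      (eventually_add_smul_mem_dualFace ha (b := -b)
        (fun v hv hav => by simp [hb v (hmem v hv hav)]) fun v hv => by
          simp [hb v (hσF hv)])).and self_mem_nhdsWithin).exists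
    have hmemM : ∀ c ∈ dualFace V w σ, c z = a z → c ∈ M := by
      intro c hc hcz
      refine ⟨hc, fun e he => (hmax e he).trans ?_⟩
      exact hcz.ge
    have h3 := (hext _ (hmemM _ h1 (by simp [hbz])) _ (hmemM _ h2 (by simp [hbz]))
      ⟨1 / 2, 1 / 2, by norm_num, by norm_num, by norm_num, by module⟩).1
    have h4 : ε • b = 0 := by simpa using h3
    have h5 : b = 0 := (smul_eq_zero.1 h4).resolve_left (ne_of_gt hpos)
    apply hf0
    ext x
    exact DFunLike.congr_fun h5 x
  refine ⟨F, hF, ?_, hσF, ?_⟩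
  · have h1 := finrank_span_eq_card (h.linearIndepOn F hF)
    have h2 : Set.range (fun x : (F : Set α) => w x) = w '' F := by
      rw [Set.image_eq_range]
    rw [h2, hspan, finrank_top] at h1
    simpa using h1.symm
  · intro u hu huσ b hbu hb
    -- The direction -b only relaxes the inequality at u, and u ∉ σ, so it is feasible.
    have := hnonpos (-b) ?_ ?_
    · simpa using this
    · intro v hv
      by_cases hvu : v = u
      · simp [hvu, hbu]
      · simp [hb v hv hvu]
    · intro v hv
      simp [hb v (hσF hv) fun hvu => huσ (hvu ▸ hv)]

/-- The facet in `exists_facet_forall_nonneg` is unique if the coordinates do not vanish. -/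
theorem facet_subset_of_pos (h : IsPolytopal Δ V w) {σ F G : Finset α} (hF : F ∈ Δ.faces)
    (hG : G ∈ Δ.faces) (hσF : σ ⊆ F) (hσG : σ ⊆ G) {z : W} {l m : α → ℝ}
    (hl : ∑ u ∈ F, l u • w u = z) (hm : ∑ u ∈ G, m u • w u = z)
    (hlpos : ∀ u ∈ F, u ∉ σ → 0 < l u) (hmpos : ∀ u ∈ G, u ∉ σ → 0 < m u) : F ⊆ G := by
  obtain ⟨hFV, a, ha1, ha2⟩ := (h.mem_faces_iff F).1 hF
  obtain ⟨hGV, b, hb1, hb2⟩ := (h.mem_faces_iff G).1 hG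
  have hle : ∀ v ∈ V, a (w v) ≤ 1 := fun v hv => by
    by_cases hvF : v ∈ F
    · exact (ha1 v hvF).le
    · exact (ha2 v hv hvF).le
  have hle' : ∀ v ∈ V, b (w v) ≤ 1 := fun v hv => by
    by_cases hvG : v ∈ G
    · exact (hb1 v hvG).le
    · exact (hb2 v hv hvG).le
  -- Since a is 1 on F and b is 1 on G, both a z - b z and its negative are sums of nonnegative
  -- terms, so every term vanishes.
  have h1 : a z - b z = ∑ u ∈ F, l u * (1 - b (w u)) := by
    rw [← hl, map_sum, map_sum, ← Finset.sum_sub_distrib]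
    refine Finset.sum_congr rfl fun u hu => ?_
    rw [map_smul, map_smul, ha1 u hu, smul_eq_mul, smul_eq_mul]
    ring
  have h2 : b z - a z = ∑ u ∈ G, m u * (1 - a (w u)) := by
    rw [← hm, map_sum, map_sum, ← Finset.sum_sub_distrib]
    refine Finset.sum_congr rfl fun u hu => ?_
    rw [map_smul, map_smul, hb1 u hu, smul_eq_mul, smul_eq_mul]
    ring
  have h3 : ∀ u ∈ F, 0 ≤ l u * (1 - b (w u)) := fun u hu => by
    by_cases huσ : u ∈ σ
    · rw [hb1 u (hσG huσ)]; simp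
    · exact mul_nonneg (hlpos u hu huσ).le (sub_nonneg.2 (hle' u (hFV hu)))
  have h4 : ∀ u ∈ G, 0 ≤ m u * (1 - a (w u)) := fun u hu => by
    by_cases huσ : u ∈ σ
    · rw [ha1 u (hσF huσ)]; simp
    · exact mul_nonneg (hmpos u hu huσ).le (sub_nonneg.2 (hle u (hGV hu)))
  have h5 : ∑ u ∈ F, l u * (1 - b (w u)) = 0 := by
    have h6 := Finset.sum_nonneg h3
    have h7 := Finset.sum_nonneg h4
    linarith
  intro u hu
  by_cases huσ : u ∈ σ
  · exact hσG huσ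
  · by_contra huG
    have h6 := (Finset.sum_eq_zero_iff_of_nonneg h3).1 h5 u hu
    have h7 := mul_pos (hlpos u hu huσ) (sub_pos.2 (hb2 u (hFV hu) huG))
    linarith

open scoped Classical in
/-- The facets, with their vertices of positive coordinate at a generic point near `p`, give a
partitioning, and so does the opposite choice. -/
theorem exists_isPartitioning [FiniteDimensional ℝ W] (h : IsPolytopal Δ V w) (p : W) :
    ∃ R : Finset α → Finset α, Δ.IsPartitioning (finrank ℝ W) R ∧
      Δ.IsPartitioning (finrank ℝ W) (fun F => F \ R F) ∧
      ∀ v, p = -w v → ∀ F ∈ Δ.facets (finrank ℝ W), v ∉ R F := by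
  have hex : ∀ F ∈ Δ.facets (finrank ℝ W), ∃ c : α → StrongDual ℝ W,
      (∀ u ∈ F, ∀ u' ∈ F, c u (w u') = if u = u' then 1 else 0) ∧
        ∀ z, ∑ u ∈ F, c u z • w u = z := by
    intro F hF
    rw [FinSimplicialComplex.mem_facets] at hF
    exact exists_coordinate_functionals (h.linearIndepOn F hF.1) hF.2
  choose! c hc hsum using hex
  obtain ⟨y, hy⟩ := exists_forall_ne_zero_and_neg
    (ι := Σ F : {F // F ∈ Δ.facets (finrank ℝ W)}, {u // u ∈ F.1})
    (fun i => c i.1.1 i.2.1) (fun i h0 => by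
      have := hc i.1.1 i.1.2 i.2.1 i.2.2 i.2.1 i.2.2
      rw [h0] at this
      simp at this) p
  have hy' : ∀ F ∈ Δ.facets (finrank ℝ W), ∀ u ∈ F,
      c F u y ≠ 0 ∧ (c F u p < 0 → c F u y < 0) := fun F hF u hu => hy ⟨⟨F, hF⟩, ⟨u, hu⟩⟩
  -- Existence gives nonnegative coordinates off σ; genericity of z makes them positive, which is
  -- what uniqueness needs.
  have key : ∀ z : W, (∀ F ∈ Δ.facets (finrank ℝ W), ∀ u ∈ F, c F u z ≠ 0) → ∀ σ ∈ Δ.faces,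
      ∃! F, F ∈ Δ.facets (finrank ℝ W) ∧ (∀ u ∈ F, u ∉ σ → 0 < c F u z) ∧ σ ⊆ F := by
    intro z hz σ hσ
    obtain ⟨F, hF, hcard, hσF, hnonneg⟩ := h.exists_facet_forall_nonneg hσ z
    have hF' : F ∈ Δ.facets (finrank ℝ W) := FinSimplicialComplex.mem_facets.2 ⟨hF, hcard⟩
    have hpos : ∀ u ∈ F, u ∉ σ → 0 < c F u z := by
      intro u hu huσ
      refine lt_of_le_of_ne (hnonneg u hu huσ (c F u) ?_ ?_) (hz F hF' u hu).symm
      · simp [hc F hF' u hu u hu]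
      · intro v hv hvu
        simp [hc F hF' u hu v hv, hvu.symm]
    refine ⟨F, ⟨hF', hpos, hσF⟩, ?_⟩
    rintro G ⟨hG, hGpos, hσG⟩
    have hG' := FinSimplicialComplex.mem_facets.1 hG
    exact Finset.eq_of_subset_of_card_le
      (h.facet_subset_of_pos hG'.1 hF hσG hσF (hsum G hG z) (hsum F hF' z) hGpos hpos)
      (by rw [hcard, hG'.2])
  refine ⟨fun F => F.filter fun u => 0 < c F u y, ⟨fun F => Finset.filter_subset _ _, ?_⟩,
    ⟨fun F => Finset.sdiff_subset, ?_⟩, ?_⟩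
  · intro σ hσ
    -- R F ⊆ σ means that y has only negative coordinates off σ, hence the sign.
    have := key (-y) (fun F hF u hu => by simpa using (hy' F hF u hu).1) σ hσ
    refine (existsUnique_congr fun F => ?_).1 this
    rw [FinSimplicialComplex.mem_facets]
    refine and_congr_right fun hF => and_congr_left fun _ => ?_
    rw [← FinSimplicialComplex.mem_facets] at hF
    simp only [Finset.subset_iff, Finset.mem_filter, map_neg, neg_pos]
    constructor
    · rintro hn u ⟨hu, hpos⟩
      by_contra huσ
      exact lt_asymm hpos (hn u hu huσ)
    · intro hn u hu huσ
      refine lt_of_le_of_ne (not_lt.1 fun hpos => huσ (hn ⟨hu, hpos⟩)) (hy' F hF u hu).1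
  · intro σ hσ
    have := key y (fun F hF u hu => (hy' F hF u hu).1) σ hσ
    refine (existsUnique_congr fun F => ?_).1 this
    rw [FinSimplicialComplex.mem_facets]
    refine and_congr_right fun hF => and_congr_left fun _ => ?_
    simp only [Finset.subset_iff, Finset.mem_sdiff, Finset.mem_filter]
    constructor
    · rintro hn u ⟨hu, hpos⟩
      by_contra huσ
      exact hpos ⟨hu, hn u hu huσ⟩
    · intro hn u hu huσ
      by_contra hpos
      exact huσ (hn ⟨hu, fun hp => hpos hp.2⟩)
  · intro v hpv F hF hvR
    rw [Finset.mem_filter] at hvR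
    -- The coordinate of -w v at v is -1 in every facet through v, and y was chosen to preserve
    -- negative signs.
    have h1 : c F v p < 0 := by
      rw [hpv, map_neg, hc F hF v hvR.1 v hvR.1]
      simp
    exact lt_asymm hvR.2 ((hy' F hF v hvR.1).2 h1)

end IsPolytopal

/-! ### The inequalities for polytopal complexes -/

namespace IsPolytopal

variable {α W : Type*} [NormedAddCommGroup W] [NormedSpace ℝ W] [FiniteDimensional ℝ W]
  {Δ : FinSimplicialComplex α} {V : Finset α} {w : α → W}

open scoped Classical in
-- Each vertex uses its own partitioning, from a generic vector near -w v; this is harmless because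
-- the h-polynomials do not depend on the partitioning.
theorem coeff_sum_hPoly_link_le (h : IsPolytopal Δ V w) (hcol : Δ.graph.Colorable (finrank ℝ W))
    (k : ℕ) : ((1 + X) * ∑ v ∈ Δ.vertices, (Δ.link {v}).hPoly).coeff k ≤
      (C (Δ.numFaces 1 : ℤ) * Δ.hPoly).coeff k := by
  have hv : ∀ v ∈ Δ.vertices, ((1 + X) * (Δ.link {v}).hPoly).coeff k ≤ Δ.hPoly.coeff k := by
    intro v hv
    obtain ⟨C⟩ := hcol
    obtain ⟨R, hR, hR', hvR⟩ := h.exists_isPartitioning (-w v)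
    -- Points that are not vertices get an arbitrary colour; they lie on no face.
    let col : α → Fin (finrank ℝ W) := fun u =>
      if hu : u ∈ Δ.vertices then C ⟨u, hu⟩ else C ⟨v, hv⟩
    refine hR.coeff_hPoly_link_le (Fintype.card_fin _) hR' h.empty_mem_faces (col := col) ?_ hv
      (hvR v rfl) k
    intro F hF u hu u' hu' heq
    have hvert : ∀ x ∈ F, x ∈ Δ.vertices := fun x hx => (Δ.mem_vertices x).2
      (Δ.down_closed F hF _ (Finset.singleton_subset_iff.2 hx))
    by_contra hne
    refine C.valid (v := ⟨u, hvert u hu⟩) (w := ⟨u', hvert u' hu'⟩)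
      ⟨fun h => hne (congrArg Subtype.val h), ?_⟩ ?_
    · refine Δ.down_closed F hF _ ?_
      rw [Finset.insert_subset_iff, Finset.singleton_subset_iff]
      exact ⟨hu, hu'⟩
    · simpa [col, hvert u hu, hvert u' hu'] using heq
  rw [Finset.mul_sum, finsetSum_coeff, coeff_C_mul, ← Δ.card_vertices]
  refine (Finset.sum_le_sum hv).trans_eq ?_
  simp

theorem hNum_le (h : IsPolytopal Δ V w) (hcol : Δ.graph.Colorable (finrank ℝ W)) (i : ℤ) :
    ((finrank ℝ W : ℤ) - i + 1) * Δ.hNum (i - 1) + (i + 1) * Δ.hNum (i + 1) ≤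
      Δ.hNum 1 * Δ.hNum i := by
  obtain ⟨R, hR, -⟩ := h.exists_isPartitioning 0
  exact FinSimplicialComplex.hNum_le_of_coeff_le hR h.empty_mem_faces
    (h.coeff_sum_hPoly_link_le hcol) i

end IsPolytopal

/-! ### Boundary complexes of simplicial polytopes are polytopal -/

namespace SimplicialPolytope

variable {E : Type*} [NormedAddCommGroup E] [NormedSpace ℝ E]

/-- The polytope, translated into the direction of its affine hull, with the origin in its
interior. -/
theorem exists_translation [FiniteDimensional ℝ E] (P : SimplicialPolytope E) :
    ∃ (x : E) (w : E → vectorSpan ℝ P.body), (∀ v ∈ P.verts, (w v : E) = v - x) ∧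
      ∃ B : ℝ, ∀ a : StrongDual ℝ (vectorSpan ℝ P.body),
        (∀ v ∈ P.verts, a (w v) ≤ 1) → ‖a‖ ≤ B := by
  classical
  obtain ⟨p, hp⟩ := P.nonempty
  have hW : vectorSpan ℝ P.body = vectorSpan ℝ (P.verts : Set E) := by
    rw [← direction_affineSpan, body, affineSpan_convexHull, direction_affineSpan]
  have hmem : ∀ v ∈ P.verts, v - p ∈ vectorSpan ℝ P.body := fun v hv => by
    rw [hW]
    exact vsub_mem_vectorSpan ℝ hv hp
  let w' : E → vectorSpan ℝ P.body := fun v => if hv : v ∈ P.verts then ⟨v - p, hmem v hv⟩ else 0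
  have hw' : ∀ v ∈ P.verts, (w' v : E) = v - p := fun v hv => by simp [w', hv]
  let s : Set (vectorSpan ℝ P.body) := w' '' P.verts
  have h0 : (0 : vectorSpan ℝ P.body) ∈ s := ⟨p, hp, Subtype.ext (by simp [hw' p hp])⟩
  have hspan : Submodule.span ℝ s = ⊤ := by
    apply Submodule.map_injective_of_injective (Submodule.injective_subtype (vectorSpan ℝ P.body))
    rw [Submodule.map_span, Submodule.map_top, Submodule.range_subtype]
    refine Eq.trans ?_ hW.symm
    rw [vectorSpan_eq_span_vsub_set_right ℝ (Finset.mem_coe.2 hp), Set.image_image]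
    congr 1
    exact Set.image_congr fun v hv => hw' v hv
  have haff : affineSpan ℝ s = ⊤ := by
    rw [AffineSubspace.affineSpan_eq_top_iff_vectorSpan_eq_top_of_nonempty ℝ _ _ ⟨0, h0⟩,
      vectorSpan_eq_span_vsub_set_right ℝ h0]
    simpa using hspan
  obtain ⟨y, hy⟩ := interior_convexHull_nonempty_iff_affineSpan_eq_top.2 haff
  obtain ⟨r, hr, hball⟩ := Metric.nhds_basis_closedBall.mem_iff.1 (mem_interior_iff_mem_nhds.1 hy)
  -- The new origin is the interior point y; a ball of radius r around it inside the hull bounds the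
  -- polar polytope by 1 / r.
  refine ⟨p + y, fun v => w' v - y, fun v hv => ?_, 1 / r, fun a ha => ?_⟩
  · rw [Submodule.coe_sub, hw' v hv, sub_sub]
  · have hle : ∀ x ∈ convexHull ℝ s, a x ≤ 1 + a y := by
      intro x hx
      refine convexHull_min ?_ (convex_halfSpace_le a.toLinearMap.isLinear (1 + a y)) hx
      rintro _ ⟨v, hv, rfl⟩
      have := ha v hv
      rw [map_sub] at this
      exact sub_le_iff_le_add.1 this
    have hle' : ∀ u ∈ Metric.closedBall (0 : vectorSpan ℝ P.body) r, a u ≤ 1 := by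
      intro u hu
      have := hle (y + u) (hball (by simpa using hu))
      rw [map_add] at this
      linarith
    refine ContinuousLinearMap.opNorm_le_bound _ (by positivity) fun z =>
      LinearMap.bound_of_ball_bound' hr 1 a.toLinearMap (fun u hu => ?_) z
    refine abs_le.2 ⟨?_, hle' u hu⟩
    have := hle' (-u) (by simpa using hu)
    rw [map_neg] at this
    have h2 : a.toLinearMap u = a u := rfl
    linarith

theorem mem_boundaryComplex [FiniteDimensional ℝ E] (P : SimplicialPolytope E) (σ : Finset E) :
    σ ∈ P.boundaryComplex.faces ↔ σ ⊆ P.verts ∧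
      ∃ F : Set E, IsProperFace P.body F ∧ (σ : Set E) = (P.verts : Set E) ∩ F := by
  classical
  rw [boundaryComplex, Finset.mem_filter, Finset.mem_powerset]

/-- A functional that is nonpositive on a bounded polytope with the origin in its interior
vanishes. -/
theorem eq_zero_of_forall_nonpos {α W : Type*} [NormedAddCommGroup W] [NormedSpace ℝ W]
    {V : Finset α} {w : α → W} {B : ℝ}
    (hB : ∀ a : StrongDual ℝ W, (∀ v ∈ V, a (w v) ≤ 1) → ‖a‖ ≤ B)
    {a : StrongDual ℝ W} (ha : ∀ v ∈ V, a (w v) ≤ 0) : a = 0 := by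
  by_contra hne
  have hpos := norm_pos_iff.2 hne
  have hB0 : 0 ≤ B := by simpa using hB 0 (by simp)
  have hk : 0 ≤ (B + 1) / ‖a‖ := by positivity
  -- Every positive multiple of a satisfies the constraints; this one has norm B + 1.
  have := hB (((B + 1) / ‖a‖) • a) fun v hv => by
    rw [smul_apply, smul_eq_mul]
    linarith [mul_nonpos_of_nonneg_of_nonpos hk (ha v hv)]
  rw [norm_smul, Real.norm_of_nonneg hk, div_mul_cancel₀ _ hpos.ne'] at this
  linarith

theorem exists_functional_of_mem_boundaryComplex [FiniteDimensional ℝ E]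
    (P : SimplicialPolytope E) {x : E} {w : E → vectorSpan ℝ P.body} {B : ℝ}
    (hw : ∀ v ∈ P.verts, (w v : E) = v - x)
    (hB : ∀ a : StrongDual ℝ (vectorSpan ℝ P.body), (∀ v ∈ P.verts, a (w v) ≤ 1) → ‖a‖ ≤ B)
    {σ : Finset E} (hσ : σ ∈ P.boundaryComplex.faces) :
    ∃ a : StrongDual ℝ (vectorSpan ℝ P.body),
      (∀ v ∈ σ, a (w v) = 1) ∧ ∀ v ∈ P.verts, v ∉ σ → a (w v) < 1 := by
  obtain ⟨hσV, F, ⟨hF, hne⟩, hσF⟩ := (P.mem_boundaryComplex σ).1 hσ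
  rcases σ.eq_empty_or_nonempty with rfl | ⟨t, ht⟩
  · exact ⟨0, by simp, by simp⟩
  have hsub : (P.verts : Set E) ⊆ P.body := subset_convexHull ℝ _
  have hmemF : ∀ v ∈ P.verts, v ∈ σ ↔ v ∈ F := fun v hv => by
    rw [← Finset.mem_coe, hσF]
    exact ⟨fun h => h.2, fun h => ⟨hv, h⟩⟩
  have htF := (hmemF t (hσV ht)).1 ht
  obtain ⟨l, hl⟩ := hF ⟨t, htF⟩
  have hmax : ∀ v ∈ F, ∀ y ∈ P.body, l y ≤ l v := fun v hv => by
    rw [hl] at hv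
    exact hv.2
  let a : StrongDual ℝ (vectorSpan ℝ P.body) := l.comp (vectorSpan ℝ P.body).subtypeL
  have ha : ∀ v ∈ P.verts, a (w v) = l v - l x := fun v hv => by
    rw [← map_sub, ← hw v hv]
    rfl
  -- This makes it possible to normalize the maximum to one. Otherwise the restricted functional is
  -- nonpositive at all vertices, hence zero, and the face is the whole polytope.
  have hpos : 0 < l t - l x := by
    by_contra hle
    have h0 : a = 0 := eq_zero_of_forall_nonpos hB fun v hv => by
      rw [ha v hv]
      linarith [hmax t htF v (hsub hv)]
    have hconst : ∀ v ∈ P.verts, l v = l x := fun v hv => by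
      have := ha v hv
      rw [h0] at this
      exact sub_eq_zero.1 this.symm
    have hge : ∀ y ∈ P.body, l x ≤ l y := fun y hy =>
      convexHull_min (fun v hv => (hconst v hv).ge)
        (convex_halfSpace_ge l.toLinearMap.isLinear (l x)) hy
    apply hne
    refine Set.Subset.antisymm (by rw [hl]; exact Set.sep_subset _ _) fun y hy => ?_
    rw [hl]
    refine ⟨hy, fun z hz => (hmax t htF z hz).trans ?_⟩
    rw [hconst t (hσV ht)]
    exact hge y hy
  refine ⟨(l t - l x)⁻¹ • a, fun v hv => ?_, fun v hv hvσ => ?_⟩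
  · have hvF := (hmemF v (hσV hv)).1 hv
    have heq : l v = l t :=
      le_antisymm (hmax t htF v (hsub (hσV hv))) (hmax v hvF t (hsub (hσV ht)))
    rw [smul_apply, ha v (hσV hv), heq, smul_eq_mul, inv_mul_cancel₀ hpos.ne']
  · have hlt : l v < l t := by
      by_contra hge
      apply hvσ
      rw [hmemF v hv, hl]
      exact ⟨hsub hv, fun z hz => (hmax t htF z hz).trans (not_lt.1 hge)⟩
    rw [smul_apply, ha v hv, smul_eq_mul, inv_mul_lt_iff₀ hpos]
    linarith

theorem mem_boundaryComplex_of_functional [FiniteDimensional ℝ E]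
    (P : SimplicialPolytope E) {x : E} {w : E → vectorSpan ℝ P.body} {B : ℝ}
    (hw : ∀ v ∈ P.verts, (w v : E) = v - x)
    (hB : ∀ a : StrongDual ℝ (vectorSpan ℝ P.body), (∀ v ∈ P.verts, a (w v) ≤ 1) → ‖a‖ ≤ B)
    {σ : Finset E} (hσV : σ ⊆ P.verts) {a : StrongDual ℝ (vectorSpan ℝ P.body)}
    (h1 : ∀ v ∈ σ, a (w v) = 1) (h2 : ∀ v ∈ P.verts, v ∉ σ → a (w v) < 1) :
    σ ∈ P.boundaryComplex.faces := by
  rw [mem_boundaryComplex]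
  refine ⟨hσV, ?_⟩
  have hsub : (P.verts : Set E) ⊆ P.body := subset_convexHull ℝ _
  rcases σ.eq_empty_or_nonempty with rfl | ⟨t, ht⟩
  · obtain ⟨p, hp⟩ := P.nonempty
    refine ⟨∅, ⟨isExposed_empty, fun h => ?_⟩, by simp⟩
    have := hsub hp
    rw [← h] at this
    exact this
  obtain ⟨g, hg⟩ := LinearMap.exists_extend (a : vectorSpan ℝ P.body →ₗ[ℝ] ℝ)
  let l : StrongDual ℝ E := LinearMap.toContinuousLinearMap g
  have hl : ∀ v ∈ P.verts, l v = a (w v) + l x := fun v hv => by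
    have : l (w v : E) = a (w v) := LinearMap.congr_fun hg (w v)
    rw [← this, hw v hv, map_sub]
    ring
  have hle : ∀ y ∈ P.body, l y ≤ 1 + l x := fun y hy => by
    refine convexHull_min (fun v hv => ?_)
      (convex_halfSpace_le l.toLinearMap.isLinear (1 + l x)) hy
    have : a (w v) ≤ 1 := by
      by_cases hvσ : v ∈ σ
      · exact (h1 v hvσ).le
      · exact (h2 v hv hvσ).le
    have h3 := hl v hv
    change l v ≤ 1 + l x
    linarith
  have heq : (σ : Set E) = (P.verts : Set E) ∩ {z ∈ P.body | ∀ y ∈ P.body, l y ≤ l z} := by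
    ext v
    constructor
    · intro hv
      refine ⟨hσV hv, hsub (hσV hv), fun y hy => ?_⟩
      rw [hl v (hσV hv), h1 v hv]
      exact hle y hy
    · rintro ⟨hvV, -, hv⟩
      by_contra hvσ
      have h3 := hv t (hsub (hσV ht))
      rw [hl t (hσV ht), h1 t ht, hl v hvV] at h3
      linarith [h2 v hvV hvσ]
  refine ⟨_, ⟨fun _ => ⟨l, rfl⟩, fun hbody => ?_⟩, heq⟩
  rw [hbody, Set.inter_eq_left.2 hsub] at heq
  -- If the face were the whole polytope, a would be 1 at every vertex and -a nonpositive there.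
  have h0 : -a = 0 := eq_zero_of_forall_nonpos hB fun v hv => by
    have hv' : v ∈ (P.verts : Set E) := hv
    rw [← heq] at hv'
    simp [h1 v hv']
  have h3 := h1 t ht
  rw [neg_eq_zero.1 h0] at h3
  simp at h3

theorem exists_isPolytopal [FiniteDimensional ℝ E] (P : SimplicialPolytope E) :
    ∃ w : E → vectorSpan ℝ P.body, IsPolytopal P.boundaryComplex P.verts w := by
  obtain ⟨x, w, hw, B, hB⟩ := P.exists_translation
  refine ⟨w, ⟨B, hB⟩, fun σ => ⟨fun hσ => ⟨((P.mem_boundaryComplex σ).1 hσ).1,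
    P.exists_functional_of_mem_boundaryComplex hw hB hσ⟩, ?_⟩, fun σ hσ => ?_⟩
  · rintro ⟨hσV, a, h1, h2⟩
    exact P.mem_boundaryComplex_of_functional hw hB hσV h1 h2
  · obtain ⟨a, h1, -⟩ := P.exists_functional_of_mem_boundaryComplex hw hB hσ
    obtain ⟨hσV, F, hF, hσF⟩ := (P.mem_boundaryComplex σ).1 hσ
    have hind := P.simplicial F hF
    rw [← hσF] at hind
    rw [linearIndepOn_finset_iff]
    intro f hf
    -- Since a is 1 on σ, the coefficients of a linear relation sum to zero, so affine independence
    -- applies.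
    have hsum : ∑ v ∈ σ, f v = 0 := by
      have := congrArg a hf
      rw [map_sum, map_zero] at this
      rw [← this]
      refine Finset.sum_congr rfl fun v hv => ?_
      rw [map_smul, h1 v hv, smul_eq_mul, mul_one]
    have hsum' : ∑ v ∈ σ, f v • v = 0 := by
      have h3 : ∑ v ∈ σ, f v • (v - x) = 0 := by
        have := congrArg (Subtype.val) hf
        rw [Submodule.coe_sum, Submodule.coe_zero] at this
        rw [← this]
        refine Finset.sum_congr rfl fun v hv => ?_
        rw [Submodule.coe_smul, hw v (hσV hv)]
      simpa [smul_sub, Finset.sum_sub_distrib, ← Finset.sum_smul, hsum] using h3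
    exact AffineIndependent.eq_zero_of_sum_eq_zero_subtype hind hsum hsum'

end SimplicialPolytope

theorem mainTheorem4 {E : Type*} [NormedAddCommGroup E] [NormedSpace ℝ E] [FiniteDimensional ℝ E]
    (P : SimplicialPolytope E) (d : ℕ) (hd : P.dim = d) (hP : P.IsBalanced) :
    (∀ k : ℕ,
      ((1 + X) * ∑ v ∈ P.boundaryComplex.vertices, (P.boundaryComplex.link {v}).hPoly).coeff k ≤
        (C (P.boundaryComplex.numFaces 1 : ℤ) * P.boundaryComplex.hPoly).coeff k) ∧
    (∀ i : ℤ,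
      ((d : ℤ) - i + 1) * P.boundaryComplex.hNum (i - 1) +
          (i + 1) * P.boundaryComplex.hNum (i + 1) ≤
        P.boundaryComplex.hNum 1 * P.boundaryComplex.hNum i) := by
  obtain ⟨w, hw⟩ := P.exists_isPolytopal
  subst hd
  exact ⟨hw.coeff_sum_hPoly_link_le hP, hw.hNum_le hP⟩
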